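/- Let $d\ge 1$ and $n\ge 0$ be integers and $[n]=\{1,\dots,n\}$. A state on a finite-dimensional complex inner product space is a positive semidefinite operator of trace one. For an operator $R$ and real $p\ge 1$ let $\|R\|_p=\big(\operatorname{tr}|R|^p\big)^{1/p}$ with $|R|=\sqrt{R^*R}$ be the Schatten $p$-norm, and for a state $\sigma$ and real $\alpha>1$ let $H_\alpha(\sigma)=\frac{1}{1-\alpha}\log\operatorname{tr}(\sigma^\alpha)$ be the Rényi entropy of order $\alpha$. Let $\mu=(\mu_I)_{I\subseteq[n]}$ be a probability measure on the set of all subsets of $[n]$. Let $Q$ be a state on $\mathbb{C}^d$ with spectral decomposition $Q=\sum_{i=1}^d\lambda_i|q_i\rangle\langle q_i|$, where $\lambda_1\ge\dots\ge\lambda_d$ and $(|q_i\rangle)_{i=1}^d$ is an orthonormal basis of $\mathbb{C}^d$. For a tuple $\rho=(\rho_I)_{I\subseteq[n]}$, where $\rho_I$ is a state on the tensor factors of $(\mathbb{C}^d)^{\otimes n}$ in $I$, define the alignment operator on $(\mathbb{C}^d)^{\otimes n}$ $$A(\rho)=\sum_{I\subseteq[n]}\mu_I\,\rho_I\otimes Q^{\otimes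 I^c},$$ where $I^c=[n]\setminus I$ and $Q^{\otimes I^c}$ acts as $Q$ on each tensor factor in $I^c$. **Theorem.** The tuple $\rho^\ast=(|q_1\rangle\langle q_1|^{\otimes I})_{I\subseteq[n]}$ is a tuple of states, and for every tuple of states $\rho=(\rho_I)_{I\subseteq[n]}$: 1. $\|A(\rho)\|_m\le\|A(\rho^\ast)\|_m$ for every integer $m\ge 1$; 2. $H_m(A(\rho^\ast))\le H_m(A(\rho))$ for every integer $m\ge 2$. That is, $\rho^\ast$ maximizes every Schatten norm of integer order, and minimizes every Rényi entropy of integer order at least $2$, over all alignment operators with the given $\mu$ and $Q$. -/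

import Mathlib

open scoped ComplexOrder MatrixOrder

noncomputable section

namespace SpinAlignment

/-- A state (density matrix): a positive semidefinite complex matrix of trace one. -/
def IsState {ι : Type*} [Fintype ι] (A : Matrix ι ι ℂ) : Prop :=
  A.PosSemidef ∧ A.trace = 1

/-- The rank-one operator `|v⟩⟨v|`. -/
def ketBra {ι : Type*} (v : EuclideanSpace ℂ ι) : Matrix ι ι ℂ :=
  Matrix.of fun i j => v i * star (v j)

/-- Operators on the tensor factors in `I`, that is, on `(ℂ^d)^{⊗ I}`, as matrices in the
product basis, which is indexed by the functions `I → Fin d`. -/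
abbrev Op (d : ℕ) {n : ℕ} (I : Finset (Fin n)) : Type :=
  Matrix (I → Fin d) (I → Fin d) ℂ

/-- The tensor power `O^{⊗ I}`: one copy of `O` on each tensor factor in `I`. -/
def tensorPow {d n : ℕ} (O : Matrix (Fin d) (Fin d) ℂ) (I : Finset (Fin n)) : Op d I :=
  Matrix.of fun x y => ∏ i : I, O (x i) (y i)

/-- The operator `A ⊗ B` on `(ℂ^d)^{⊗ n}`, with `A` acting on the factors in `I` and `B` on the
factors in the complement of `I`. -/
def tensorCompl {d n : ℕ} {I : Finset (Fin n)} (A : Op d I) (B : Op d Iᶜ) :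
    Matrix (Fin n → Fin d) (Fin n → Fin d) ℂ :=
  Matrix.of fun x y =>
    A (fun i => x i) (fun i => y i) * B (fun i => x i) (fun i => y i)

/-- The alignment operator `∑_I μ_I ρ_I ⊗ Q^{⊗ Iᶜ}`, the sum being over all subsets `I`. -/
def alignmentOp {d n : ℕ} (μ : Finset (Fin n) → ℝ) (Q : Matrix (Fin d) (Fin d) ℂ)
    (ρ : (I : Finset (Fin n)) → Op d I) : Matrix (Fin n → Fin d) (Fin n → Fin d) ℂ :=
  ∑ I : Finset (Fin n), (μ I : ℂ) • tensorCompl (ρ I) (tensorPow Q Iᶜ)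

/-- The Schatten `p`-norm `(tr |R|^p)^{1/p}`, where `|R| = √(R* R)`; absolute value and power
are taken in the functional calculus. -/
def schattenNorm {ι : Type*} [Fintype ι] [DecidableEq ι] (p : ℝ) (R : Matrix ι ι ℂ) : ℝ :=
  (Matrix.trace (CFC.abs R ^ p)).re ^ (1 / p)

/-- The Rényi entropy of order `α`, with `α ≠ 1`, of a state: `(1 - α)⁻¹ log tr (ρ^α)`. -/
def renyiEntropy {ι : Type*} [Fintype ι] [DecidableEq ι] (α : ℝ) (ρ : Matrix ι ι ℂ) : ℝ :=
  (1 / (1 - α)) * Real.log (Matrix.trace (ρ ^ α)).re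

end SpinAlignment

end

/-! Both claims reduce to comparing `tr A^m`. Conjugating by `U^{⊗n}`, with `U` the eigenbasis of
`Q`, makes `Q` diagonal and preserves these traces. Expand the power over tuples `I_0, …, I_{m-1}`
of subsets and closed paths of multi-indices; since `Q` is diagonal, step `j` can change only
coordinates in `I_j`. The inequality holds for each tuple separately.

By positivity an entry of `ρ_I` is at most the geometric mean of two diagonal entries, so AM-GM
bounds a path's contribution by products of probabilities read at all starts, or all ends, of the
steps (`norm_prod_apply_le`). These readings, with the coordinates that no `I_j` touches, determine
the path (`injOn_restrict_frozenPart`). Bounding eigenvalues at touched coordinates by the largest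
one therefore lets the probabilities be summed independently to one (`sum_closedPaths_le`); what
remains is the tuple's contribution for the aligned states. -/

open scoped Kronecker

namespace SpinAlignment

/-! ### Traces of matrix powers, norms and entropies -/

section General

variable {ι : Type*} [Fintype ι] [DecidableEq ι]

/-- A vanishing trace would make the state nilpotent, contradicting trace one. Strict positivity is
what monotonicity of `log` requires. -/
theorem IsState.trace_pow_pos {A : Matrix ι ι ℂ} (hA : IsState A) (m : ℕ) :
    0 < (A ^ m).trace.re := by
  have hpos := hA.1.pow m
  have h0 : 0 ≤ (A ^ m).trace := hpos.trace_nonneg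
  have hne : (A ^ m).trace ≠ 0 := by
    intro h
    have hz : A ^ m = 0 := hpos.trace_eq_zero_iff.1 h
    have hnil := Matrix.isNilpotent_trace_of_isNilpotent (M := A) ⟨m, hz⟩
    rw [hA.2] at hnil
    exact one_ne_zero hnil.eq_zero
  exact (Complex.pos_iff.1 (lt_of_le_of_ne h0 hne.symm)).1

theorem schattenNorm_natCast {A : Matrix ι ι ℂ} (hA : A.PosSemidef) (m : ℕ) :
    schattenNorm m A = (A ^ m).trace.re ^ (1 / (m : ℝ)) := by
  have h0 : (0 : Matrix ι ι ℂ) ≤ A := Matrix.nonneg_iff_posSemidef.2 hA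
  rw [schattenNorm, CFC.abs_of_nonneg A h0, CFC.rpow_natCast A m h0]

theorem renyiEntropy_natCast {A : Matrix ι ι ℂ} (hA : A.PosSemidef) (m : ℕ) :
    renyiEntropy m A = (1 / (1 - (m : ℝ))) * Real.log (A ^ m).trace.re := by
  have h0 : (0 : Matrix ι ι ℂ) ≤ A := Matrix.nonneg_iff_posSemidef.2 hA
  rw [renyiEntropy, CFC.rpow_natCast A m h0]

theorem schattenNorm_le_of_trace_pow_le {A B : Matrix ι ι ℂ} (hA : A.PosSemidef)
    (hB : B.PosSemidef) {m : ℕ} (h : (A ^ m).trace.re ≤ (B ^ m).trace.re) :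
    schattenNorm m A ≤ schattenNorm m B := by
  rw [schattenNorm_natCast hA, schattenNorm_natCast hB]
  exact Real.rpow_le_rpow (Complex.nonneg_iff.1 (hA.pow m).trace_nonneg).1 h (by positivity)

theorem renyiEntropy_le_of_trace_pow_le {A B : Matrix ι ι ℂ} (hA : IsState A)
    (hB : B.PosSemidef) {m : ℕ} (hm : 2 ≤ m) (h : (A ^ m).trace.re ≤ (B ^ m).trace.re) :
    renyiEntropy m B ≤ renyiEntropy m A := by
  rw [renyiEntropy_natCast hA.1, renyiEntropy_natCast hB]
  have hm' : (2 : ℝ) ≤ m := by exact_mod_cast hm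
  refine mul_le_mul_of_nonpos_left (Real.log_le_log (hA.trace_pow_pos m) h) ?_
  exact one_div_nonpos.2 (by linarith)

theorem IsState.conj {κ : Type*} [Fintype κ] [DecidableEq κ] {A : Matrix ι ι ℂ}
    (hA : IsState A) {V : Matrix κ ι ℂ} (hV : V.conjTranspose * V = 1) :
    IsState (V * A * V.conjTranspose) := by
  refine ⟨hA.1.mul_mul_conjTranspose_same V, ?_⟩
  rw [Matrix.trace_mul_comm, ← Matrix.mul_assoc, hV, Matrix.one_mul, hA.2]

theorem trace_conj_pow {V : Matrix ι ι ℂ} (hV : V.conjTranspose * V = 1) (A : Matrix ι ι ℂ)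
    (m : ℕ) : ((V * A * V.conjTranspose) ^ m).trace = (A ^ m).trace := by
  have hpow : (V * A * V.conjTranspose) ^ m = V * A ^ m * V.conjTranspose := by
    induction m with
    | zero => rw [pow_zero, pow_zero, Matrix.mul_one, mul_eq_one_comm.1 hV]
    | succ k ih =>
      rw [pow_succ, ih, pow_succ]
      calc V * A ^ k * V.conjTranspose * (V * A * V.conjTranspose)
          = V * A ^ k * (V.conjTranspose * V) * A * V.conjTranspose := by
            simp only [Matrix.mul_assoc]
        _ = V * (A ^ k * A) * V.conjTranspose := by
            rw [hV, Matrix.mul_one, Matrix.mul_assoc V]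
  rw [hpow, Matrix.trace_mul_comm, ← Matrix.mul_assoc, hV, Matrix.one_mul]

omit [Fintype ι] [DecidableEq ι] in
-- The 2×2 submatrix on `a`, `b` has nonnegative determinant.
theorem norm_sq_apply_le_of_posSemidef {A : Matrix ι ι ℂ} (hA : A.PosSemidef) (a b : ι) :
    ‖A a b‖ ^ 2 ≤ (A a a).re * (A b b).re := by
  have h := (hA.submatrix ![a, b]).det_nonneg
  rw [Matrix.det_fin_two] at h
  have hh : A b a = star (A a b) := (hA.1.apply b a).symm
  have ha := (Complex.nonneg_iff.1 (hA.diag_nonneg (i := a))).2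
  have hb := (Complex.nonneg_iff.1 (hA.diag_nonneg (i := b))).2
  have h1 := (Complex.nonneg_iff.1 h).1
  simp [hh, ← ha, ← hb] at h1
  rw [Complex.sq_norm, Complex.normSq_apply]
  linarith

/-- An entry of a matrix power as a sum over paths. -/
theorem pow_succ_apply_eq_sum_paths {R : Type*} [CommSemiring R] (A : Matrix ι ι R) (m : ℕ)
    (a b : ι) :
    (A ^ (m + 1)) a b = ∑ x : Fin m → ι, ∏ j : Fin (m + 1),
      A ((Fin.cons a x : Fin (m + 1) → ι) j) ((Fin.snoc x b : Fin (m + 1) → ι) j) := by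
  induction m generalizing a with
  | zero => simp [Fin.snoc]
  | succ m ih =>
    rw [pow_succ', Matrix.mul_apply, ← (Fin.consEquiv fun _ => ι).sum_comp,
      Fintype.sum_prod_type]
    refine Finset.sum_congr rfl fun c _ => ?_
    rw [ih, Finset.mul_sum]
    refine Finset.sum_congr rfl fun x _ => ?_
    rw [Fin.prod_univ_succ (n := m + 1)]
    simp [Fin.consEquiv, ← Fin.cons_snoc_eq_snoc_cons]

/-- The trace of a matrix power as a sum over closed paths. -/
theorem trace_pow_succ_eq_sum_paths {R : Type*} [CommSemiring R] (A : Matrix ι ι R) (m : ℕ) :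
    (A ^ (m + 1)).trace = ∑ x : Fin (m + 1) → ι, ∏ j, A (x j) (x (j + 1)) := by
  rw [← (Fin.consEquiv fun _ => ι).sum_comp, Fintype.sum_prod_type]
  refine Finset.sum_congr rfl fun a _ => ?_
  rw [Matrix.diag_apply, pow_succ_apply_eq_sum_paths]
  refine Finset.sum_congr rfl fun x _ => Finset.prod_congr rfl fun j _ => ?_
  congr 1
  -- Addition in `Fin (m + 1)` is cyclic, so the last step returns to `x 0`.
  refine Fin.lastCases ?_ (fun i => ?_) j <;> simp [Fin.consEquiv]

end General

/-! ### Tensor products and reduction to diagonal `Q` -/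

section Tensor

variable {d n : ℕ}

/-- Splitting a multi-index into its parts inside and outside `I`. -/
def splitEquiv (d : ℕ) {n : ℕ} (I : Finset (Fin n)) :
    (Fin n → Fin d) ≃ (I → Fin d) × ((Iᶜ : Finset (Fin n)) → Fin d) where
  toFun x := (fun i => x i, fun i => x i)
  invFun f i := if h : i ∈ I then f.1 ⟨i, h⟩ else f.2 ⟨i, Finset.mem_compl.2 h⟩
  left_inv x := by ext i; by_cases h : i ∈ I <;> simp [h]
  right_inv f := by
    refine Prod.ext ?_ ?_
    · ext i; simp
    · ext ⟨i, hi⟩; simp [Finset.mem_compl.1 hi]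

theorem tensorCompl_eq_submatrix {I : Finset (Fin n)} (A : Op d I) (B : Op d Iᶜ) :
    tensorCompl A B = (A ⊗ₖ B).submatrix (splitEquiv d I) (splitEquiv d I) := rfl

theorem tensorCompl_mul {I : Finset (Fin n)} (A A' : Op d I) (B B' : Op d Iᶜ) :
    tensorCompl (A * A') (B * B') = tensorCompl A B * tensorCompl A' B' := by
  simp only [tensorCompl_eq_submatrix, Matrix.submatrix_mul_equiv, Matrix.mul_kronecker_mul]

theorem tensorCompl_conjTranspose {I : Finset (Fin n)} (A : Op d I) (B : Op d Iᶜ) :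
    (tensorCompl A B).conjTranspose = tensorCompl A.conjTranspose B.conjTranspose := by
  ext x y
  simp [tensorCompl]

theorem IsState.tensorCompl {I : Finset (Fin n)} {A : Op d I} {B : Op d Iᶜ} (hA : IsState A)
    (hB : IsState B) : IsState (tensorCompl A B) := by
  rw [tensorCompl_eq_submatrix]
  refine ⟨(hA.1.kronecker hB.1).submatrix _, ?_⟩
  have : ((A ⊗ₖ B).submatrix (splitEquiv d I) (splitEquiv d I)).trace = (A ⊗ₖ B).trace :=
    (splitEquiv d I).sum_comp fun z => (A ⊗ₖ B) z z
  rw [this, Matrix.trace_kronecker, hA.2, hB.2, one_mul]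

theorem tensorPow_mul (A B : Matrix (Fin d) (Fin d) ℂ) (I : Finset (Fin n)) :
    tensorPow (A * B) I = tensorPow A I * tensorPow B I := by
  ext x y
  simp only [tensorPow, Matrix.of_apply, Matrix.mul_apply, Fintype.prod_sum,
    Finset.prod_mul_distrib]

theorem tensorPow_conjTranspose (A : Matrix (Fin d) (Fin d) ℂ) (I : Finset (Fin n)) :
    (tensorPow A I).conjTranspose = tensorPow A.conjTranspose I := by
  ext x y
  simp [tensorPow]

theorem tensorPow_diagonal (c : Fin d → ℂ) (I : Finset (Fin n)) :
    tensorPow (Matrix.diagonal c) I = Matrix.diagonal fun x => ∏ i, c (x i) := by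
  ext x y
  by_cases h : x = y
  · subst h; simp [tensorPow]
  · obtain ⟨i, hi⟩ := Function.ne_iff.1 h
    rw [Matrix.diagonal_apply_ne _ h]
    exact Finset.prod_eq_zero (Finset.mem_univ i) (Matrix.diagonal_apply_ne _ hi)

theorem tensorPow_one (I : Finset (Fin n)) :
    tensorPow (1 : Matrix (Fin d) (Fin d) ℂ) I = 1 := by
  rw [← Matrix.diagonal_one, tensorPow_diagonal]
  simp

theorem tensorPow_conjTranspose_mul_self {U : Matrix (Fin d) (Fin d) ℂ}
    (hU : U.conjTranspose * U = 1) (I : Finset (Fin n)) :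
    (tensorPow U I).conjTranspose * tensorPow U I = 1 := by
  rw [tensorPow_conjTranspose, ← tensorPow_mul, hU, tensorPow_one]

theorem isState_diagonal_iff {ι : Type*} [Fintype ι] [DecidableEq ι] {c : ι → ℂ} :
    IsState (Matrix.diagonal c) ↔ (∀ i, 0 ≤ c i) ∧ ∑ i, c i = 1 := by
  rw [IsState, Matrix.posSemidef_diagonal_iff, Matrix.trace_diagonal]

theorem IsState.tensorPow_diagonal {c : Fin d → ℂ} (hc : IsState (Matrix.diagonal c))
    (I : Finset (Fin n)) : IsState (tensorPow (Matrix.diagonal c) I) := by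
  rw [isState_diagonal_iff] at hc
  rw [SpinAlignment.tensorPow_diagonal, isState_diagonal_iff]
  refine ⟨fun x => Finset.prod_nonneg fun i _ => hc.1 _, ?_⟩
  rw [← Fintype.prod_sum (fun (_ : I) a => c a)]
  simp [hc.2]

/-- The unitary `U^{⊗ n}`. -/
def tensorAll (U : Matrix (Fin d) (Fin d) ℂ) (n : ℕ) :
    Matrix (Fin n → Fin d) (Fin n → Fin d) ℂ :=
  Matrix.of fun x y => ∏ i, U (x i) (y i)

theorem tensorCompl_tensorPow (U : Matrix (Fin d) (Fin d) ℂ) (I : Finset (Fin n)) :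
    tensorCompl (tensorPow U I) (tensorPow U Iᶜ) = tensorAll U n := by
  ext x y
  simp only [tensorCompl, tensorPow, tensorAll, Matrix.of_apply]
  rw [Finset.prod_coe_sort I fun i => U (x i) (y i),
    Finset.prod_coe_sort Iᶜ fun i => U (x i) (y i), Finset.prod_mul_prod_compl]

theorem tensorAll_conjTranspose_mul_self {U : Matrix (Fin d) (Fin d) ℂ}
    (hU : U.conjTranspose * U = 1) (n : ℕ) :
    (tensorAll U n).conjTranspose * tensorAll U n = 1 := by
  rw [← tensorCompl_tensorPow U ∅, tensorCompl_conjTranspose, ← tensorCompl_mul,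
    tensorPow_conjTranspose_mul_self hU, tensorPow_conjTranspose_mul_self hU,
    tensorCompl_eq_submatrix, Matrix.one_kronecker_one, Matrix.submatrix_one_equiv]

/-- `U^{⊗I} ⊗ U^{⊗Iᶜ}` is the same unitary for every `I`, so it factors out of the sum. -/
theorem alignmentOp_conj (μ : Finset (Fin n) → ℝ) (Q U : Matrix (Fin d) (Fin d) ℂ)
    (ρ : (I : Finset (Fin n)) → Op d I) :
    alignmentOp μ (U * Q * U.conjTranspose)
        (fun I => tensorPow U I * ρ I * (tensorPow U I).conjTranspose) =
      tensorAll U n * alignmentOp μ Q ρ * (tensorAll U n).conjTranspose := by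
  simp only [alignmentOp, Matrix.mul_sum, Matrix.sum_mul, Matrix.mul_smul, Matrix.smul_mul]
  refine Finset.sum_congr rfl fun I _ => ?_
  rw [tensorPow_mul, tensorPow_mul, ← tensorPow_conjTranspose U, tensorCompl_mul,
    tensorCompl_mul, ← tensorCompl_conjTranspose, tensorCompl_tensorPow]

theorem isState_alignmentOp {μ : Finset (Fin n) → ℝ} (hμ_nonneg : ∀ I, 0 ≤ μ I)
    (hμ_sum : ∑ I, μ I = 1) {c : Fin d → ℂ} (hc : IsState (Matrix.diagonal c))
    {ρ : (I : Finset (Fin n)) → Op d I} (hρ : ∀ I, IsState (ρ I)) :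
    IsState (alignmentOp μ (Matrix.diagonal c) ρ) := by
  have hst := fun I => (hρ I).tensorCompl (hc.tensorPow_diagonal Iᶜ)
  refine ⟨Matrix.posSemidef_sum _ fun I _ =>
    (hst I).1.smul (Complex.zero_le_real.2 (hμ_nonneg I)), ?_⟩
  rw [alignmentOp, Matrix.trace_sum]
  simp only [Matrix.trace_smul, (hst _).2, smul_eq_mul, mul_one]
  exact_mod_cast hμ_sum

/-- The matrix whose columns are the vectors of an orthonormal basis. -/
noncomputable def basisMatrix (q : OrthonormalBasis (Fin d) ℂ (EuclideanSpace ℂ (Fin d))) :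
    Matrix (Fin d) (Fin d) ℂ :=
  Matrix.of fun a i => q i a

theorem basisMatrix_conjTranspose_mul_self
    (q : OrthonormalBasis (Fin d) ℂ (EuclideanSpace ℂ (Fin d))) :
    (basisMatrix q).conjTranspose * basisMatrix q = 1 := by
  ext i j
  have h := orthonormal_iff_ite.1 q.orthonormal i j
  rw [PiLp.inner_apply] at h
  simpa [basisMatrix, Matrix.mul_apply, Matrix.one_apply, mul_comm] using h

theorem sum_smul_ketBra_eq (q : OrthonormalBasis (Fin d) ℂ (EuclideanSpace ℂ (Fin d)))
    (c : Fin d → ℂ) :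
    ∑ i, c i • ketBra (q i) =
      basisMatrix q * Matrix.diagonal c * (basisMatrix q).conjTranspose := by
  ext a b
  rw [Matrix.mul_apply, Matrix.sum_apply]
  refine Finset.sum_congr rfl fun i _ => ?_
  simp [basisMatrix, ketBra, Matrix.mul_diagonal]
  ring

theorem ketBra_eq_conj_diagonal (q : OrthonormalBasis (Fin d) ℂ (EuclideanSpace ℂ (Fin d)))
    (i : Fin d) :
    ketBra (q i) = basisMatrix q * Matrix.diagonal (Pi.single i 1) *
      (basisMatrix q).conjTranspose := by
  rw [← sum_smul_ketBra_eq]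
  simp [Pi.single_apply]

end Tensor


/-! ### Counting closed paths -/

section Paths

variable {d n m : ℕ}

theorem forall_of_add_one {p : Fin (m + 1) → Prop} (h : ∀ j, p j → p (j + 1))
    {i : Fin (m + 1)} (hi : p i) (j : Fin (m + 1)) : p j := by
  have key : ∀ t, p (i + t) := fun t => by
    induction t using Fin.induction with
    | zero => simpa using hi
    | succ t ih =>
      rw [← Fin.coeSucc_eq_succ, ← add_assoc]
      exact h _ ih
  simpa using key (j - i)

theorem forall_of_sub_one {p : Fin (m + 1) → Prop} (h : ∀ j, p (j + 1) → p j)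
    {i : Fin (m + 1)} (hi : p i) (j : Fin (m + 1)) : p j := by
  by_contra hj
  exact forall_of_add_one (p := fun j => ¬ p j) (fun j hj hj' => hj (h j hj')) hj i hi

/-- The closed paths of multi-indices whose `j`-th step changes only coordinates in `I j`. -/
def closedPaths (d : ℕ) {n m : ℕ} (I : Fin (m + 1) → Finset (Fin n)) :
    Finset (Fin (m + 1) → Fin n → Fin d) :=
  Finset.univ.filter fun x => ∀ j, ∀ k ∉ I j, x j k = x (j + 1) k

/-- The value of a closed path at time zero on the coordinates outside all `I j`, with the other
coordinates set to zero. -/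
def frozenPart [NeZero d] (I : Fin (m + 1) → Finset (Fin n)) (x : Fin (m + 1) → Fin n → Fin d)
    (k : Fin n) : Fin d :=
  if ∃ j, k ∈ I j then 0 else x 0 k

/-- An untouched coordinate is constant along the path, hence known from time zero. A touched one is
known at `s j` whenever `k ∈ I j` and does not change in the other steps, so its values propagate
around the cycle: backwards for starts, forwards for ends. -/
theorem injOn_restrict_frozenPart [NeZero d] (I : Fin (m + 1) → Finset (Fin n))
    {s : Fin (m + 1) → Fin (m + 1)} (hs : s = id ∨ s = fun j => j + 1) :
    Set.InjOn (fun x => ((fun j (i : I j) => x (s j) i : (j : Fin (m + 1)) → I j → Fin d),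
      frozenPart I x)) (closedPaths d I : Set (Fin (m + 1) → Fin n → Fin d)) := by
  intro x hx x' hx' h
  simp only [closedPaths, Finset.coe_filter, Finset.mem_univ, true_and, Set.mem_ofPred_eq]
    at hx hx'
  obtain ⟨h1, h2⟩ := Prod.ext_iff.1 h
  have h1' : ∀ j, ∀ k ∈ I j, x (s j) k = x' (s j) k := fun j k hk =>
    congrFun (congrFun h1 j) ⟨k, hk⟩
  have hone : ∀ k, ∃ j, x j k = x' j k := by
    intro k
    by_cases hk : ∃ j, k ∈ I j
    · obtain ⟨j, hj⟩ := hk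
      exact ⟨s j, h1' j k hj⟩
    · refine ⟨0, ?_⟩
      simpa [frozenPart, hk] using congrFun h2 k
  ext j k : 2
  obtain ⟨i, hi⟩ := hone k
  rcases hs with rfl | rfl
  · refine forall_of_sub_one (p := fun j => x j k = x' j k) (fun j hj => ?_) hi j
    by_cases hk : k ∈ I j
    · exact h1' j k hk
    · rw [hx j k hk, hx' j k hk, hj]
  · refine forall_of_add_one (p := fun j => x j k = x' j k) (fun j hj => ?_) hi j
    by_cases hk : k ∈ I j
    · exact h1' j k hk
    · rw [← hx j k hk, ← hx' j k hk, hj]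

/-- The weight `∏_{k ∉ I} c (x k)`. -/
def complWeight (c : Fin d → ℝ) (I : Finset (Fin n)) (x : Fin n → Fin d) : ℝ :=
  ∏ k, if k ∈ I then 1 else c (x k)

/-- The diagonal entry at `x` of `|0⟩⟨0|^{⊗ I} ⊗ (diag c)^{⊗ Iᶜ}`. -/
def alignedWeight [NeZero d] (c : Fin d → ℝ) (I : Finset (Fin n)) (x : Fin n → Fin d) : ℝ :=
  ∏ k, if k ∈ I then if x k = 0 then 1 else 0 else c (x k)

theorem complWeight_nonneg {c : Fin d → ℝ} (hc : ∀ a, 0 ≤ c a) (I : Finset (Fin n))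
    (x : Fin n → Fin d) : 0 ≤ complWeight c I x :=
  Finset.prod_nonneg fun k _ => by split_ifs <;> simp [hc]

theorem alignedWeight_nonneg [NeZero d] {c : Fin d → ℝ} (hc : ∀ a, 0 ≤ c a)
    (I : Finset (Fin n)) (x : Fin n → Fin d) : 0 ≤ alignedWeight c I x :=
  Finset.prod_nonneg fun k _ => by split_ifs <;> simp [hc]

/-- Untouched coordinates give equal factors; at touched ones `c 0` dominates, and `frozenPart` is
zero there. -/
theorem prod_complWeight_le [NeZero d] {c : Fin d → ℝ} (hc : ∀ a, 0 ≤ c a)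
    (hmax : ∀ a, c a ≤ c 0) {I : Fin (m + 1) → Finset (Fin n)}
    {x : Fin (m + 1) → Fin n → Fin d} (hx : x ∈ closedPaths d I) :
    ∏ j, complWeight c (I j) (x j) ≤ ∏ j, alignedWeight c (I j) (frozenPart I x) := by
  simp only [closedPaths, Finset.mem_filter, Finset.mem_univ, true_and] at hx
  refine Finset.prod_le_prod (fun j _ => complWeight_nonneg hc _ _) fun j _ => ?_
  refine Finset.prod_le_prod (fun k _ => by split_ifs <;> simp [hc]) fun k _ => ?_
  by_cases hk : ∃ j, k ∈ I j
  · by_cases hj : k ∈ I j <;> simp [hj, frozenPart, hk, hmax]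
  · have hcov := hk
    push Not at hk
    have heq : x 0 k = x j k :=
      forall_of_add_one (p := fun j => x 0 k = x j k)
        (fun j hj => hj.trans (hx j k (hk j))) (i := 0) rfl j
    simp only [frozenPart, if_neg hcov, if_neg (hk j), heq, le_refl]

/-- A sum over closed paths of a product of probabilities, one for each step, and of weights on
the coordinates which the steps leave unchanged. -/
theorem sum_closedPaths_le [NeZero d] {c : Fin d → ℝ} (hc : ∀ a, 0 ≤ c a)
    (hmax : ∀ a, c a ≤ c 0) (I : Fin (m + 1) → Finset (Fin n))
    {p : (j : Fin (m + 1)) → (I j → Fin d) → ℝ} (hp : ∀ j y, 0 ≤ p j y)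
    (hp_sum : ∀ j, ∑ y, p j y = 1) {s : Fin (m + 1) → Fin (m + 1)}
    (hs : s = id ∨ s = fun j => j + 1) :
    ∑ x ∈ closedPaths d I, (∏ j, p j fun i => x (s j) i) * ∏ j, complWeight c (I j) (x j) ≤
      ∑ z, ∏ j, alignedWeight c (I j) z := by
  let φ : (Fin (m + 1) → Fin n → Fin d) →
      ((j : Fin (m + 1)) → I j → Fin d) × (Fin n → Fin d) :=
    fun x => (fun j i => x (s j) i, frozenPart I x)
  let g : ((j : Fin (m + 1)) → I j → Fin d) × (Fin n → Fin d) → ℝ :=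
    fun w => (∏ j, p j (w.1 j)) * ∏ j, alignedWeight c (I j) w.2
  have hg : ∀ w, 0 ≤ g w := fun w =>
    mul_nonneg (Finset.prod_nonneg fun j _ => hp j _)
      (Finset.prod_nonneg fun j _ => alignedWeight_nonneg hc _ _)
  calc ∑ x ∈ closedPaths d I, (∏ j, p j fun i => x (s j) i) * ∏ j, complWeight c (I j) (x j)
      ≤ ∑ x ∈ closedPaths d I, g (φ x) := Finset.sum_le_sum fun x hx =>
        mul_le_mul_of_nonneg_left (prod_complWeight_le hc hmax hx)
          (Finset.prod_nonneg fun j _ => hp j _)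
    _ = ∑ w ∈ (closedPaths d I).image φ, g w :=
        (Finset.sum_image (injOn_restrict_frozenPart I hs)).symm
    -- Dropping the constraint of coming from a path decouples the probabilities from the weights.
    _ ≤ ∑ w, g w :=
        Finset.sum_le_sum_of_subset_of_nonneg (Finset.subset_univ _) fun w _ _ => hg w
    _ = ∑ z, ∏ j, alignedWeight c (I j) z := by
        rw [Fintype.sum_prod_type]
        simp only [g, ← Finset.mul_sum, ← Finset.sum_mul]
        rw [← Fintype.prod_sum p]
        simp [hp_sum]

end Paths

/-! ### Comparison of the traces -/

section Trace

variable {d n m : ℕ}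

/-- AM-GM is applied to the whole products, not factor by factor, so that each term reads every step
at the same end, as injectivity needs. -/
theorem norm_prod_apply_le (I : Fin (m + 1) → Finset (Fin n))
    {ρ : (I : Finset (Fin n)) → Op d I} (hρ : ∀ I, IsState (ρ I))
    (x : Fin (m + 1) → Fin n → Fin d) :
    ∏ j, ‖ρ (I j) (fun i => x j i) (fun i => x (j + 1) i)‖ ≤
      ((∏ j, (ρ (I j) (fun i => x j i) (fun i => x j i)).re) +
        ∏ j, (ρ (I j) (fun i => x (j + 1) i) (fun i => x (j + 1) i)).re) / 2 := by
  have hdiag : ∀ (J : Finset (Fin n)) (y : J → Fin d), 0 ≤ (ρ J y y).re := fun J y =>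
    (Complex.nonneg_iff.1 (hρ J).1.diag_nonneg).1
  have hsq : (∏ j, ‖ρ (I j) (fun i => x j i) (fun i => x (j + 1) i)‖) ^ 2 ≤
      (∏ j, (ρ (I j) (fun i => x j i) (fun i => x j i)).re) *
        ∏ j, (ρ (I j) (fun i => x (j + 1) i) (fun i => x (j + 1) i)).re := by
    rw [← Finset.prod_pow, ← Finset.prod_mul_distrib]
    exact Finset.prod_le_prod (fun j _ => by positivity) fun j _ =>
      norm_sq_apply_le_of_posSemidef (hρ (I j)).1 _ _
  have h1 : 0 ≤ ∏ j, (ρ (I j) (fun i => x j i) (fun i => x j i)).re :=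
    Finset.prod_nonneg fun j _ => hdiag _ _
  have h2 : 0 ≤ ∏ j, (ρ (I j) (fun i => x (j + 1) i) (fun i => x (j + 1) i)).re :=
    Finset.prod_nonneg fun j _ => hdiag _ _
  set a := ∏ j, (ρ (I j) (fun i => x j i) (fun i => x j i)).re
  set b := ∏ j, (ρ (I j) (fun i => x (j + 1) i) (fun i => x (j + 1) i)).re
  refine (le_abs_self _).trans (abs_le_of_sq_le_sq (hsq.trans ?_) (by positivity))
  linarith [sq_nonneg (a - b)]

theorem tensorCompl_diagonal_apply (c : Fin d → ℝ) {I : Finset (Fin n)} (A : Op d I)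
    (x y : Fin n → Fin d) :
    tensorCompl A (tensorPow (Matrix.diagonal fun a => (c a : ℂ)) Iᶜ) x y =
      if ∀ k ∉ I, x k = y k then
        A (fun i => x i) (fun i => y i) * (complWeight c I x : ℂ) else 0 := by
  rw [tensorPow_diagonal, tensorCompl, Matrix.of_apply, Matrix.diagonal_apply]
  have hiff : ((fun i : (Iᶜ : Finset (Fin n)) => x i) = fun i : (Iᶜ : Finset (Fin n)) => y i) ↔
      ∀ k ∉ I, x k = y k := by
    simp [funext_iff]
  have hw : ∏ i : (Iᶜ : Finset (Fin n)), (c (x i) : ℂ) = (complWeight c I x : ℂ) := by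
    rw [Finset.prod_coe_sort Iᶜ fun i => (c (x i) : ℂ), complWeight, Complex.ofReal_prod,
      ← Fintype.prod_ite_mem]
    refine Finset.prod_congr rfl fun k _ => ?_
    by_cases hk : k ∈ I <;> simp [hk]
  simp only [hiff, hw, mul_ite, mul_zero]

theorem aligned_apply [NeZero d] (c : Fin d → ℝ) (I : Finset (Fin n)) :
    tensorCompl (tensorPow (Matrix.diagonal (Pi.single 0 1)) I)
        (tensorPow (Matrix.diagonal fun a => (c a : ℂ)) Iᶜ) =
      Matrix.diagonal fun x => (alignedWeight c I x : ℂ) := by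
  ext x y
  rw [tensorCompl_diagonal_apply, tensorPow_diagonal]
  by_cases h : x = y
  · subst h
    simp only [implies_true, if_true, Matrix.diagonal_apply_eq]
    rw [Finset.prod_coe_sort I fun i => (Pi.single 0 1 : Fin d → ℂ) (x i), complWeight,
      alignedWeight, ← Fintype.prod_ite_mem, Complex.ofReal_prod, Complex.ofReal_prod,
      ← Finset.prod_mul_distrib]
    refine Finset.prod_congr rfl fun k _ => ?_
    by_cases hk : k ∈ I <;> by_cases h0 : x k = 0 <;> simp [hk, h0]
  · rw [Matrix.diagonal_apply_ne _ h]
    split_ifs with h'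
    · rw [Matrix.diagonal_apply_ne, zero_mul]
      intro h''
      refine h (funext fun k => ?_)
      by_cases hk : k ∈ I
      · exact congrFun h'' ⟨k, hk⟩
      · exact h' k hk
    · rfl

theorem trace_aligned_pow [NeZero d] (μ : Finset (Fin n) → ℝ) (c : Fin d → ℝ) (m : ℕ) :
    ((alignmentOp μ (Matrix.diagonal fun a => (c a : ℂ))
        fun I => tensorPow (Matrix.diagonal (Pi.single 0 1)) I) ^ m).trace.re =
      ∑ I : Fin m → Finset (Fin n), (∏ j, μ (I j)) * ∑ z, ∏ j, alignedWeight c (I j) z := by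
  have hA : (alignmentOp μ (Matrix.diagonal fun a => (c a : ℂ))
      fun I => tensorPow (Matrix.diagonal (Pi.single 0 1)) I) =
      Matrix.diagonal fun x => ((∑ I, μ I * alignedWeight c I x : ℝ) : ℂ) := by
    ext x y
    simp only [alignmentOp, aligned_apply, Matrix.sum_apply, Matrix.smul_apply,
      Matrix.diagonal_apply, smul_eq_mul]
    split_ifs <;> simp
  rw [hA, Matrix.diagonal_pow, Matrix.trace_diagonal, Complex.re_sum]
  simp only [Finset.mul_sum, ← Finset.prod_mul_distrib]
  rw [Finset.sum_comm]
  refine Finset.sum_congr rfl fun x _ => ?_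
  rw [Pi.pow_apply, ← Complex.ofReal_pow, Complex.ofReal_re,
    ← Fintype.prod_sum fun (_ : Fin m) I => μ I * alignedWeight c I x]
  simp

theorem trace_alignmentOp_pow_le [NeZero d] {μ : Finset (Fin n) → ℝ}
    (hμ : ∀ I, 0 ≤ μ I) {c : Fin d → ℝ} (hc : ∀ a, 0 ≤ c a) (hmax : ∀ a, c a ≤ c 0)
    {ρ : (I : Finset (Fin n)) → Op d I} (hρ : ∀ I, IsState (ρ I)) (m : ℕ) :
    ((alignmentOp μ (Matrix.diagonal fun a => (c a : ℂ)) ρ) ^ (m + 1)).trace.re ≤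
      ((alignmentOp μ (Matrix.diagonal fun a => (c a : ℂ))
        fun I => tensorPow (Matrix.diagonal (Pi.single 0 1)) I) ^ (m + 1)).trace.re := by
  have hdiag : ∀ (J : Finset (Fin n)) (y : J → Fin d), 0 ≤ (ρ J y y).re := fun J y =>
    (Complex.nonneg_iff.1 (hρ J).1.diag_nonneg).1
  have hsum : ∀ J : Finset (Fin n), ∑ y, (ρ J y y).re = 1 := fun J => by
    rw [← Complex.re_sum]
    exact congrArg Complex.re (hρ J).2
  rw [trace_aligned_pow]
  calc ((alignmentOp μ (Matrix.diagonal fun a => (c a : ℂ)) ρ) ^ (m + 1)).trace.re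
      = ∑ I : Fin (m + 1) → Finset (Fin n), (∏ j, μ (I j)) *
          (∑ x : Fin (m + 1) → Fin n → Fin d, ∏ j, tensorCompl (ρ (I j))
            (tensorPow (Matrix.diagonal fun a => (c a : ℂ)) (I j)ᶜ) (x j) (x (j + 1))).re := by
        rw [trace_pow_succ_eq_sum_paths]
        simp only [alignmentOp, Matrix.sum_apply, Matrix.smul_apply, smul_eq_mul,
          Fintype.prod_sum, Finset.prod_mul_distrib]
        rw [Finset.sum_comm, Complex.re_sum]
        refine Finset.sum_congr rfl fun I _ => ?_
        rw [← Finset.mul_sum, ← Complex.ofReal_prod, Complex.re_ofReal_mul]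
    _ ≤ _ := Finset.sum_le_sum fun I _ => mul_le_mul_of_nonneg_left ?_
        (Finset.prod_nonneg fun j _ => hμ _)
  -- The two halves of the AM-GM bound, read at starts and at ends, have the same upper bound.
  have hid := sum_closedPaths_le hc hmax I (p := fun j y => (ρ (I j) y y).re)
    (fun j y => hdiag _ _) (fun j => hsum _) (Or.inl rfl)
  have hsucc := sum_closedPaths_le hc hmax I (p := fun j y => (ρ (I j) y y).re)
    (fun j y => hdiag _ _) (fun j => hsum _) (Or.inr rfl)
  calc (∑ x : Fin (m + 1) → Fin n → Fin d, ∏ j, tensorCompl (ρ (I j))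
        (tensorPow (Matrix.diagonal fun a => (c a : ℂ)) (I j)ᶜ) (x j) (x (j + 1))).re
      = (∑ x ∈ closedPaths d I, ∏ j, tensorCompl (ρ (I j))
        (tensorPow (Matrix.diagonal fun a => (c a : ℂ)) (I j)ᶜ) (x j) (x (j + 1))).re := by
        congr 1
        refine (Finset.sum_subset (Finset.subset_univ _) fun x _ hx => ?_).symm
        simp only [closedPaths, Finset.mem_filter, Finset.mem_univ, true_and] at hx
        push Not at hx
        obtain ⟨j, k, hk, hne⟩ := hx
        refine Finset.prod_eq_zero (Finset.mem_univ j) ?_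
        rw [tensorCompl_diagonal_apply, if_neg fun h => hne (h k hk)]
    _ ≤ ∑ x ∈ closedPaths d I, ‖∏ j, tensorCompl (ρ (I j))
        (tensorPow (Matrix.diagonal fun a => (c a : ℂ)) (I j)ᶜ) (x j) (x (j + 1))‖ :=
        (Complex.re_le_norm _).trans (norm_sum_le _ _)
    _ ≤ ∑ x ∈ closedPaths d I,
          (((∏ j, (ρ (I j) (fun i => x j i) (fun i => x j i)).re) +
            ∏ j, (ρ (I j) (fun i => x (j + 1) i) (fun i => x (j + 1) i)).re) / 2) *
          ∏ j, complWeight c (I j) (x j) := by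
        refine Finset.sum_le_sum fun x hx => ?_
        simp only [closedPaths, Finset.mem_filter, Finset.mem_univ, true_and] at hx
        have hw : ∀ j, ‖tensorCompl (ρ (I j))
            (tensorPow (Matrix.diagonal fun a => (c a : ℂ)) (I j)ᶜ) (x j) (x (j + 1))‖ =
            ‖ρ (I j) (fun i => x j i) (fun i => x (j + 1) i)‖ *
              complWeight c (I j) (x j) := fun j => by
          rw [tensorCompl_diagonal_apply, if_pos (hx j), norm_mul, Complex.norm_real,
            Real.norm_of_nonneg (complWeight_nonneg hc _ _)]
        rw [norm_prod]
        simp only [hw, Finset.prod_mul_distrib]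
        exact mul_le_mul_of_nonneg_right (norm_prod_apply_le I hρ x)
          (Finset.prod_nonneg fun j _ => complWeight_nonneg hc _ _)
    _ ≤ ∑ z, ∏ j, alignedWeight c (I j) z := by
        simp only [add_div, add_mul, Finset.sum_add_distrib, div_mul_eq_mul_div,
          ← Finset.sum_div]
        simp only [id] at hid hsucc
        linarith

end Trace

end SpinAlignment

open SpinAlignment in
theorem mainTheorem1 (d n : ℕ) [NeZero d]
    (μ : Finset (Fin n) → ℝ) (hμ_nonneg : ∀ I, 0 ≤ μ I) (hμ_sum : ∑ I, μ I = 1)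
    (Q : Matrix (Fin d) (Fin d) ℂ) (hQ : SpinAlignment.IsState Q)
    (q : OrthonormalBasis (Fin d) ℂ (EuclideanSpace ℂ (Fin d)))
    (lam : Fin d → ℝ) (hlam : Antitone lam)
    (hQ_eq : Q = ∑ i, (lam i : ℂ) • SpinAlignment.ketBra (q i)) :
    (∀ I : Finset (Fin n),
      SpinAlignment.IsState (SpinAlignment.tensorPow (SpinAlignment.ketBra (q 0)) I)) ∧
    ∀ ρ : (I : Finset (Fin n)) → SpinAlignment.Op d I, (∀ I, SpinAlignment.IsState (ρ I)) →
      (∀ m : ℕ, 1 ≤ m →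
        SpinAlignment.schattenNorm m (SpinAlignment.alignmentOp μ Q ρ) ≤
          SpinAlignment.schattenNorm m (SpinAlignment.alignmentOp μ Q
            fun I => SpinAlignment.tensorPow (SpinAlignment.ketBra (q 0)) I)) ∧
      (∀ m : ℕ, 2 ≤ m →
        SpinAlignment.renyiEntropy m (SpinAlignment.alignmentOp μ Q
            fun I => SpinAlignment.tensorPow (SpinAlignment.ketBra (q 0)) I) ≤
          SpinAlignment.renyiEntropy m (SpinAlignment.alignmentOp μ Q ρ)) := by
  set U := basisMatrix q with hU_def
  have hU : U.conjTranspose * U = 1 := basisMatrix_conjTranspose_mul_self q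
  have hU' : U * U.conjTranspose = 1 := mul_eq_one_comm.1 hU
  have hV := tensorAll_conjTranspose_mul_self hU n
  rw [sum_smul_ketBra_eq q fun i => (lam i : ℂ), ← hU_def] at hQ_eq
  have hD : IsState (Matrix.diagonal fun i => (lam i : ℂ)) := by
    have h := hQ.conj (V := U.conjTranspose) (by rwa [Matrix.conjTranspose_conjTranspose])
    rw [hQ_eq, Matrix.conjTranspose_conjTranspose] at h
    have e : U.conjTranspose * (U * (Matrix.diagonal fun i => (lam i : ℂ)) *
        U.conjTranspose) * U = (U.conjTranspose * U) *
        (Matrix.diagonal fun i => (lam i : ℂ)) * (U.conjTranspose * U) := by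
      simp only [Matrix.mul_assoc]
    rwa [e, hU, Matrix.one_mul, Matrix.mul_one] at h
  have hlam0 : ∀ a, 0 ≤ lam a := fun a =>
    Complex.zero_le_real.1 ((isState_diagonal_iff.1 hD).1 a)
  have hE : IsState (Matrix.diagonal (Pi.single 0 1 : Fin d → ℂ)) := by
    refine isState_diagonal_iff.2 ⟨fun i => ?_, by simp⟩
    rw [Pi.single_apply]
    split_ifs <;> simp
  have hstar : ∀ I : Finset (Fin n), tensorPow (ketBra (q 0)) I = tensorPow U I *
      tensorPow (Matrix.diagonal (Pi.single 0 1)) I * (tensorPow U I).conjTranspose := by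
    intro I
    rw [ketBra_eq_conj_diagonal, tensorPow_mul, tensorPow_mul, tensorPow_conjTranspose]
  have hstarState : ∀ I : Finset (Fin n), IsState (tensorPow (ketBra (q 0)) I) := by
    intro I
    rw [hstar]
    exact (hE.tensorPow_diagonal I).conj (tensorPow_conjTranspose_mul_self hU I)
  refine ⟨hstarState, fun ρ hρ => ?_⟩
  -- The given states written in the eigenbasis of `Q`.
  let σ : (I : Finset (Fin n)) → Op d I := fun I =>
    (tensorPow U I).conjTranspose * ρ I * tensorPow U I
  have hW : ∀ I : Finset (Fin n), tensorPow U I * (tensorPow U I).conjTranspose = 1 :=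
    fun I => mul_eq_one_comm.1 (tensorPow_conjTranspose_mul_self hU I)
  have hσ : ∀ I, IsState (σ I) := fun I => by
    have h := (hρ I).conj (V := (tensorPow U I).conjTranspose)
      (by rw [Matrix.conjTranspose_conjTranspose, hW])
    rwa [Matrix.conjTranspose_conjTranspose] at h
  have hρσ : ρ = fun I => tensorPow U I * σ I * (tensorPow U I).conjTranspose := by
    funext I
    have e : tensorPow U I * σ I * (tensorPow U I).conjTranspose =
        (tensorPow U I * (tensorPow U I).conjTranspose) * ρ I *
          (tensorPow U I * (tensorPow U I).conjTranspose) := by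
      simp only [σ, Matrix.mul_assoc]
    rw [e, hW, Matrix.one_mul, Matrix.mul_one]
  have hA : alignmentOp μ Q ρ = tensorAll U n *
      alignmentOp μ (Matrix.diagonal fun i => (lam i : ℂ)) σ *
      (tensorAll U n).conjTranspose := by
    rw [← alignmentOp_conj, ← hρσ, hQ_eq]
  have hB : (alignmentOp μ Q fun I => tensorPow (ketBra (q 0)) I) = tensorAll U n *
      alignmentOp μ (Matrix.diagonal fun i => (lam i : ℂ))
        (fun I => tensorPow (Matrix.diagonal (Pi.single 0 1)) I) *
      (tensorAll U n).conjTranspose := by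
    rw [← alignmentOp_conj, hQ_eq]
    simp only [hstar]
  have hAst : IsState (alignmentOp μ Q ρ) := by
    rw [hA]
    exact (isState_alignmentOp hμ_nonneg hμ_sum hD hσ).conj hV
  have hBst : IsState (alignmentOp μ Q fun I => tensorPow (ketBra (q 0)) I) := by
    rw [hB]
    exact (isState_alignmentOp hμ_nonneg hμ_sum hD fun I => hE.tensorPow_diagonal I).conj hV
  have hle : ∀ m : ℕ, 1 ≤ m → ((alignmentOp μ Q ρ) ^ m).trace.re ≤
      ((alignmentOp μ Q fun I => tensorPow (ketBra (q 0)) I) ^ m).trace.re := by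
    intro m hm
    obtain ⟨m, rfl⟩ := Nat.exists_eq_add_of_le' hm
    rw [hA, hB, trace_conj_pow hV, trace_conj_pow hV]
    exact trace_alignmentOp_pow_le hμ_nonneg hlam0 (fun a => hlam (Fin.zero_le a)) hσ m
  exact ⟨fun m hm => schattenNorm_le_of_trace_pow_le hAst.1 hBst.1 (hle m hm),
    fun m hm => renyiEntropy_le_of_trace_pow_le hAst hBst.1 hm (hle m (by omega))⟩
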